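/- **Setting.** Let $\mathbf{M}$ and $\mathbf{Q}$ be small symmetric monoidal categories with the same objects, let $J:\mathbf{M}\to\mathbf{Q}$ be a strict monoidal functor that is the identity on objects, let $\mathrm{Bit}$ be an object and $\mathrm{zero},\mathrm{one}:I\to\mathrm{Bit}$ morphisms of $\mathbf{M}$ such that $\mathrm{inj}_1=J(\mathrm{zero})$ and $\mathrm{inj}_2=J(\mathrm{one})$ exhibit $\mathrm{Bit}$ as a coproduct $I+I$ in $\mathbf{Q}$, and suppose that the tensor product of $\mathbf{Q}$ distributes over this coproduct. Let $\mathbf{V}$ be the cartesian closed category of bisets: objects are triples $(A_0,A_1,f:A_1\to A_0)$ of two sets and a function, morphisms are commuting squares. Let $\mathbf{C}$ be the $\mathbf{V}$-category with the objects of $\mathbf{M}$ and $\mathbf{C}(A,B)=(\mathbf{Q}(A,B),\mathbf{M}(A,B),J)$. A $\mathbf{V}$-functor $F:\mathbf{C}^{\mathrm{op}}\to\mathbf{V}$ induces a functor $F^0:\mathbf{Q}^{\mathrm{op}}\to\mathbf{Set}$, $F^0A=(FA)_0$; call $F$ smooth if $F^0$ sends every binary coproduct that exists in $\mathbf{Q}$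 to a product of sets. Let $\widetilde{\mathbf{C}}$ be the category of smooth $\mathbf{V}$-functors and $\mathbf{V}$-natural transformations, and let $\overline{y}A=\mathbf{C}(-,A)$ be the Lambek (corestricted Yoneda) embedding. Let $\widetilde{\mathbf{Q}}$ be the full subcategory of $\mathbf{Set}^{\mathbf{Q}^{\mathrm{op}}}$ of the functors that send every binary coproduct existing in $\mathbf{Q}$ to a product, let $L$ be the left adjoint of its inclusion, with unit $u$, and let $\kappa:\mathbf{Q}\to\widetilde{\mathbf{Q}}$, $\kappa A=\mathbf{Q}(-,A)$, be its Lambek embedding. For a $\mathbf{V}$-functor $F:\mathbf{C}^{\mathrm{op}}\to\mathbf{V}$ let $\widetilde{L}F$ be the smooth functor with $(\widetilde{L}F)A=\bigl((LF^0)A,\ (FA)_1,\ (FA)_1\to F^0A\xrightarrow{u}(LF^0)A\bigr)$. Put $\mathrm{Bool}=\widetilde{L}(\overline{y}I+\overline{y}I)$ (the coproduct of two copies of $\overline{y}I$ in $\widetilde{\mathbf{C}}$), with injections $\iota_1,\iota_2:\overline{y}I\to\mathrm{Bool}$, and write $\mathrm{Bit}$ also for $\overline{y}(\mathrm{Bit})\in\widetilde{\mathbf{C}}$.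 Finally, let $\widetilde{T}$ be the monad on $\widetilde{\mathbf{C}}$ with $(\widetilde{T}F)A=((FA)_0,(FA)_0,\mathrm{id})$, whose unit $\eta_F:F\to\widetilde{T}F$ has components $(\mathrm{id},\,(FA)_1\to(FA)_0)$. **Theorem.** The embedding $\kappa:\mathbf{Q}\to\widetilde{\mathbf{Q}}$ preserves the coproduct $\mathrm{Bit}=I+I$. Moreover, there are $\mathbf{V}$-natural transformations $\mathsf{init}:\mathrm{Bool}\to\mathrm{Bit}$ and $\mathsf{Dyn}:\mathrm{Bit}\to\widetilde{T}\,\mathrm{Bool}$ in $\widetilde{\mathbf{C}}$ such that 1. $\mathsf{init}\circ\iota_1=\overline{y}(\mathrm{zero})$ and $\mathsf{init}\circ\iota_2=\overline{y}(\mathrm{one})$, i.e. $\mathsf{init}=[\mathsf{zero},\mathsf{one}]$; 2. $\widetilde{T}\,\mathsf{init}:\widetilde{T}\,\mathrm{Bool}\to\widetilde{T}\,\mathrm{Bit}$ is an isomorphism; 3. $\widetilde{T}\,\mathsf{init}\circ\mathsf{Dyn}=\eta_{\mathrm{Bit}}$, i.e. $\mathsf{Dyn}=(\widetilde{T}\,\mathsf{init})^{-1}\circ\eta_{\mathrm{Bit}}$;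 4. $\mathsf{Dyn}\circ\mathsf{init}=\eta_{\mathrm{Bool}}$. -/

import Mathlib

open CategoryTheory Limits MonoidalCategory Opposite
open scoped MonoidalClosed

universe u

/-! ### The cartesian closed category `V` of bisets -/

/-- A biset is a triple `(A₀, A₁, f : A₁ → A₀)`. -/
structure Biset : Type (u + 1) where
  obj₀ : Type u
  obj₁ : Type u
  str : obj₁ → obj₀

namespace Biset

/-- A morphism of bisets is a commuting square of functions. -/
@[ext]
structure Hom (A B : Biset.{u}) : Type u where
  map₀ : A.obj₀ → B.obj₀
  map₁ : A.obj₁ → B.obj₁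
  comm : ∀ a, B.str (map₁ a) = map₀ (A.str a)

instance : Category.{u} Biset.{u} where
  Hom := Hom
  id A := { map₀ := fun a => a, map₁ := fun a => a, comm := fun _ => rfl }
  comp f g :=
    { map₀ := fun a => g.map₀ (f.map₀ a), map₁ := fun a => g.map₁ (f.map₁ a)
      comm := fun a => by rw [g.comm, f.comm] }

@[ext]
theorem hom_ext {A B : Biset.{u}} {f g : A ⟶ B} (h₀ : ∀ a, f.map₀ a = g.map₀ a)
    (h₁ : ∀ a, f.map₁ a = g.map₁ a) : f = g :=
  Hom.ext (funext h₀) (funext h₁)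

@[simp] theorem id_map₀ (A : Biset.{u}) (a : A.obj₀) : Hom.map₀ (𝟙 A) a = a := rfl

@[simp] theorem id_map₁ (A : Biset.{u}) (a : A.obj₁) : Hom.map₁ (𝟙 A) a = a := rfl

@[simp] theorem comp_map₀ {A B C : Biset.{u}} (f : A ⟶ B) (g : B ⟶ C) (a : A.obj₀) :
    (f ≫ g).map₀ a = g.map₀ (f.map₀ a) := rfl

@[simp] theorem comp_map₁ {A B C : Biset.{u}} (f : A ⟶ B) (g : B ⟶ C) (a : A.obj₁) :
    (f ≫ g).map₁ a = g.map₁ (f.map₁ a) := rfl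

/-- The one-point biset. -/
def unit : Biset.{u} := ⟨PUnit, PUnit, id⟩

/-- The product of bisets, formed levelwise. -/
def prod (A B : Biset.{u}) : Biset.{u} :=
  ⟨A.obj₀ × B.obj₀, A.obj₁ × B.obj₁, fun x => (A.str x.1, B.str x.2)⟩

def terminalCone : LimitCone (Functor.empty.{0} Biset.{u}) where
  cone := asEmptyCone unit
  isLimit := IsTerminal.ofUniqueHom
    (fun _ => { map₀ := fun _ => ⟨⟩, map₁ := fun _ => ⟨⟩, comm := fun _ => rfl })
    (fun _ _ => rfl)

def prodCone (A B : Biset.{u}) : LimitCone (pair A B) where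
  cone := BinaryFan.mk (P := prod A B)
    { map₀ := Prod.fst, map₁ := Prod.fst, comm := fun _ => rfl }
    { map₀ := Prod.snd, map₁ := Prod.snd, comm := fun _ => rfl }
  isLimit := BinaryFan.IsLimit.mk _
    (fun f g =>
      { map₀ := fun x => (f.map₀ x, g.map₀ x), map₁ := fun x => (f.map₁ x, g.map₁ x)
        comm := fun x => Prod.ext (f.comm x) (g.comm x) })
    (fun _ _ => rfl) (fun _ _ => rfl)
    (fun f g m h₁ h₂ => by subst h₁ h₂; rfl)

instance : CartesianMonoidalCategory Biset.{u} :=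
  CartesianMonoidalCategory.ofChosenFiniteProducts terminalCone prodCone

instance : BraidedCategory Biset.{u} := .ofCartesianMonoidalCategory

/-- The exponential `A ⇒ B`, with `(A ⇒ B)₀` the functions `A₀ → B₀` and `(A ⇒ B)₁` the morphisms
of bisets `A ⟶ B`. -/
def exp (A B : Biset.{u}) : Biset.{u} := ⟨A.obj₀ → B.obj₀, A ⟶ B, fun h => h.map₀⟩

def expFunctor (A : Biset.{u}) : Biset.{u} ⥤ Biset.{u} where
  obj := exp A
  map f := { map₀ := fun g a => f.map₀ (g a), map₁ := fun h => h ≫ f, comm := fun _ => rfl }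

def expAdjunction (A : Biset.{u}) : tensorLeft A ⊣ expFunctor A where
  unit :=
    { app := fun Z =>
        { map₀ := fun z a => (a, z)
          map₁ := fun z =>
            { map₀ := fun a => (a, Z.str z), map₁ := fun a => (a, z), comm := fun _ => rfl }
          comm := fun _ => rfl }
      naturality := fun _ _ f => hom_ext (fun _ => rfl)
        (fun a => hom_ext (fun _ => Prod.ext rfl (f.comm a)) (fun _ => rfl)) }
  counit :=
    { app := fun _ =>
        { map₀ := fun x => x.2 x.1
          map₁ := fun x => x.2.map₁ x.1
          comm := fun x => x.2.comm x.1 }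
      naturality := fun _ _ _ => rfl }
  left_triangle_components := fun _ => rfl
  right_triangle_components := fun _ => rfl

/-- Bisets are cartesian closed; hence they are enriched over themselves by
`MonoidalClosed.enrichedCategorySelf`. -/
instance : MonoidalClosed Biset.{u} where
  closed A := { rightAdj := expFunctor A, adj := expAdjunction A }

/-- The category of sets as a trivial biset-enriched category. -/
instance : EnrichedCategory Biset.{u} (Type u) where
  Hom A B := ⟨A → B, A → B, fun f => f⟩
  id _ := { map₀ := fun _ a => a, map₁ := fun _ a => a, comm := fun _ => rfl }
  comp _ _ _ :=
    { map₀ := fun p a => p.2 (p.1 a), map₁ := fun p a => p.2 (p.1 a), comm := fun _ => rfl }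
  id_comp _ _ := rfl
  comp_id _ _ := rfl
  assoc _ _ _ _ := rfl

/-- The `V`-functor `U₀ : V → Set`. -/
def U₀ : EnrichedFunctor Biset.{u} Biset.{u} (Type u) where
  obj A := A.obj₀
  map _ _ := { map₀ := fun f => f, map₁ := fun f => f.map₀, comm := fun _ => rfl }
  map_id _ := rfl
  map_comp _ _ _ := rfl

/-- The `V`-functor `Δ : Set → V`, `Δ X = (X, X, id)`. -/
def Δ : EnrichedFunctor Biset.{u} (Type u) Biset.{u} where
  obj X := ⟨X, X, fun x => x⟩
  map _ _ :=
    { map₀ := fun f => f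
      map₁ := fun f => { map₀ := f, map₁ := f, comm := fun _ => rfl }
      comm := fun _ => rfl }
  map_id _ := rfl
  map_comp _ _ _ := rfl

end Biset

/-! ### Product-preserving presheaves -/

/-- Presheaves of sets on `Q` that turn every binary coproduct existing in `Q` into a product of
sets (binary coproducts of `Q` are the binary products of `Qᵒᵖ`). -/
abbrev prodPreserving (Q : Type u) [SmallCategory Q] : ObjectProperty (Qᵒᵖ ⥤ Type u) :=
  ObjectProperty.preservesLimitsOfShape (Discrete WalkingPair)

/-- Product-preserving presheaves form a reflective subcategory. -/
instance prodPreserving_isRightAdjoint (Q : Type u) [SmallCategory Q] :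
    (prodPreserving Q).ι.IsRightAdjoint := by
  have : Fact Cardinal.aleph0.{u}.IsRegular := Cardinal.fact_isRegular_aleph0
  have hy : ∀ X : Q, IsCardinalPresentable (shrinkYoneda.{u}.obj X) Cardinal.aleph0.{u} :=
    fun X => isCardinalPresentable_of_iso (uliftYonedaIsoShrinkYoneda.{u}.app X) _
  have key : ∀ P : ObjectProperty (Qᵒᵖ ⥤ Type u),
      P = (⨆ (F : Discrete WalkingPair ⥤ Qᵒᵖ),
        MorphismProperty.ofHoms (Presheaf.preservesLimitHomFamily.{u} F)).isLocal →
      P.ι.IsRightAdjoint := by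
    rintro _ rfl
    refine MorphismProperty.isRightAdjoint_ι_isLocal _ Cardinal.aleph0.{u} ?_
    intro X Y f hf
    simp only [MorphismProperty.iSup_iff] at hf
    obtain ⟨F, ⟨h⟩⟩ := hf
    refine ⟨?_, hy _⟩
    have : ∀ k, IsCardinalPresentable ((F.leftOp ⋙ shrinkYoneda.{u}).obj k) Cardinal.aleph0.{u} :=
      fun k => hy _
    refine isCardinalPresentable_of_isColimit _
      (colimit.isColimit (F.leftOp ⋙ shrinkYoneda.{u})) _ ?_
    rw [hasCardinalLT_aleph0_iff]
    infer_instance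
  exact key _ Presheaf.preservesLimitsOfShape_eq_isLocal

/-- The left adjoint `L` of the inclusion of product-preserving presheaves. -/
noncomputable def prodReflector (Q : Type u) [SmallCategory Q] :
    (Qᵒᵖ ⥤ Type u) ⥤ (prodPreserving Q).FullSubcategory :=
  (prodPreserving Q).ι.leftAdjoint

/-- The adjunction between `L` and the inclusion. -/
noncomputable def prodReflectorAdj (Q : Type u) [SmallCategory Q] :
    prodReflector Q ⊣ (prodPreserving Q).ι :=
  Adjunction.ofIsRightAdjoint _

/-- The Lambek embedding `κ : Q → Q̃`, the Yoneda embedding corestricted to the full subcategory of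
product-preserving presheaves. -/
def lambekQ (Q : Type u) [SmallCategory Q] : Q ⥤ (prodPreserving Q).FullSubcategory :=
  (prodPreserving Q).lift yoneda (fun A =>
    (inferInstance : PreservesLimitsOfShape (Discrete WalkingPair) (yoneda.obj A)))

/-! ### Strict monoidal functors -/

/-- A monoidal functor is strict if it preserves the unit and the tensor product on the nose, with
identities as structure morphisms. -/
structure IsStrictMonoidal {M Q : Type u} [SmallCategory M] [SmallCategory Q] [MonoidalCategory M]
    [MonoidalCategory Q] (J : M ⥤ Q) [J.Monoidal] : Prop where
  obj_unit : 𝟙_ Q = J.obj (𝟙_ M)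
  ε_eq : Functor.LaxMonoidal.ε J = eqToHom obj_unit
  obj_tensor : ∀ A B : M, J.obj A ⊗ J.obj B = J.obj (A ⊗ B)
  μ_eq : ∀ A B : M, Functor.LaxMonoidal.μ J A B = eqToHom (obj_tensor A B)

section Model

variable {M Q : Type u} [SmallCategory M] [SmallCategory Q]

/-! ### The `V`-category `C` and its `V`-category of presheaves -/

/-- The category `Q`, with its objects named by those of `M` along `J`. When `J` is the identity (or
just bijective) on objects, this is `Q` itself. -/
abbrev QOb (J : M ⥤ Q) : Type u := InducedCategory Q J.obj

/-- The objects of the `V`-category `C`. -/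
def CCat (_ : M ⥤ Q) : Type u := M

/-- The `V`-category `C`, with `C(A, B) = (Q(A, B), M(A, B), J)`. -/
instance (J : M ⥤ Q) : EnrichedCategory Biset.{u} (CCat J) where
  Hom A B := ⟨J.obj A ⟶ J.obj B, (show M from A) ⟶ (show M from B), fun f => J.map f⟩
  id A := { map₀ := fun _ => 𝟙 (J.obj A), map₁ := fun _ => 𝟙 (show M from A)
            comm := fun _ => J.map_id _ }
  comp _ _ _ :=
    { map₀ := fun p => p.1 ≫ p.2, map₁ := fun p => p.1 ≫ p.2
      comm := fun _ => J.map_comp _ _ }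
  id_comp A B := Biset.hom_ext (fun f => Category.id_comp (X := J.obj A) (Y := J.obj B) f)
    (fun f => Category.id_comp (X := (show M from A)) (Y := (show M from B)) f)
  comp_id A B := Biset.hom_ext (fun f => Category.comp_id (X := J.obj A) (Y := J.obj B) f)
    (fun f => Category.comp_id (X := (show M from A)) (Y := (show M from B)) f)
  assoc A B C D := Biset.hom_ext
    (fun p => (Category.assoc (W := J.obj A) (X := J.obj B) (Y := J.obj C) (Z := J.obj D)
      p.1 p.2.1 p.2.2))
    (fun p => (Category.assoc (W := (show M from A)) (X := (show M from B)) (Y := (show M from C))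
      (Z := (show M from D)) p.1 p.2.1 p.2.2))

/-- The objects of the presheaf category of `C`: the `V`-functors from `Cᵒᵖ` to `V`. -/
structure CBar (J : M ⥤ Q) : Type (u + 1) where
  fn : EnrichedFunctor Biset.{u} (CCat J)ᵒᵖ Biset.{u}

namespace CBar

variable {J : M ⥤ Q}

/-- The biset `F A`. -/
abbrev at' (F : CBar J) (A : M) : Biset.{u} := F.fn.obj (op (show CCat J from A))

/-- The action of a morphism of `Q` on level `0`. -/
def act₀ (F : CBar J) {A B : M} (f : J.obj B ⟶ J.obj A) : (F.at' A).obj₀ → (F.at' B).obj₀ :=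
  (F.fn.map (op (show CCat J from A)) (op (show CCat J from B))).map₀ f

/-- The action of a morphism of `M`. -/
def act₁ (F : CBar J) {A B : M} (f : B ⟶ A) : F.at' A ⟶ F.at' B :=
  (F.fn.map (op (show CCat J from A)) (op (show CCat J from B))).map₁ f

theorem act₁_map₀ (F : CBar J) {A B : M} (f : B ⟶ A) : (F.act₁ f).map₀ = F.act₀ (J.map f) :=
  (F.fn.map (op (show CCat J from A)) (op (show CCat J from B))).comm f

theorem act₀_id (F : CBar J) (A : M) (x : (F.at' A).obj₀) : F.act₀ (𝟙 (J.obj A)) x = x :=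
  congrFun (congrFun (congrArg Biset.Hom.map₀ (F.fn.map_id (op (show CCat J from A)))) ⟨⟩) x

theorem act₀_comp (F : CBar J) {A B C : M} (f : J.obj B ⟶ J.obj A) (g : J.obj C ⟶ J.obj B)
    (x : (F.at' A).obj₀) : F.act₀ (g ≫ f) x = F.act₀ g (F.act₀ f x) :=
  congrFun (congrFun (congrArg Biset.Hom.map₀ (F.fn.map_comp (op (show CCat J from A))
    (op (show CCat J from B)) (op (show CCat J from C)))) (f, g)) x

theorem act₁_id (F : CBar J) (A : M) : F.act₁ (𝟙 A) = 𝟙 (F.at' A) :=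
  congrFun (congrArg Biset.Hom.map₁ (F.fn.map_id (op (show CCat J from A)))) ⟨⟩

theorem act₁_comp (F : CBar J) {A B C : M} (f : B ⟶ A) (g : C ⟶ B) :
    F.act₁ (g ≫ f) = F.act₁ f ≫ F.act₁ g :=
  congrFun (congrArg Biset.Hom.map₁ (F.fn.map_comp (op (show CCat J from A))
    (op (show CCat J from B)) (op (show CCat J from C)))) (f, g)

/-- A `V`-functor `Cᵒᵖ → V` from a family of bisets with actions of `Q` on level `0` and of `M` on
level `1`. -/
def ofActions (obj : M → Biset.{u})
    (a₀ : ∀ {A B : M}, (J.obj B ⟶ J.obj A) → (obj A).obj₀ → (obj B).obj₀)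
    (a₁ : ∀ {A B : M}, (B ⟶ A) → (obj A).obj₁ → (obj B).obj₁)
    (comm : ∀ {A B : M} (f : B ⟶ A) (x : (obj A).obj₁),
      (obj B).str (a₁ f x) = a₀ (J.map f) ((obj A).str x))
    (id₀ : ∀ (A : M) (x : (obj A).obj₀), a₀ (𝟙 (J.obj A)) x = x)
    (id₁ : ∀ (A : M) (x : (obj A).obj₁), a₁ (𝟙 A) x = x)
    (comp₀ : ∀ {A B C : M} (f : J.obj B ⟶ J.obj A) (g : J.obj C ⟶ J.obj B) (x : (obj A).obj₀),
      a₀ (g ≫ f) x = a₀ g (a₀ f x))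
    (comp₁ : ∀ {A B C : M} (f : B ⟶ A) (g : C ⟶ B) (x : (obj A).obj₁),
      a₁ (g ≫ f) x = a₁ g (a₁ f x)) : CBar J where
  fn :=
    { obj := fun A => obj A.unop
      map := fun A B =>
        { map₀ := fun f => a₀ (A := A.unop) (B := B.unop) f
          map₁ := fun f =>
            { map₀ := a₀ (A := A.unop) (B := B.unop) (J.map f)
              map₁ := a₁ (A := A.unop) (B := B.unop) f
              comm := comm (A := A.unop) (B := B.unop) f }
          comm := fun _ => rfl }
      map_id := fun A => Biset.hom_ext (fun _ => funext fun x => id₀ A.unop x)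
        (fun _ => Biset.hom_ext
          (fun x => (congrArg (fun f => a₀ (A := A.unop) (B := A.unop) f x) (J.map_id A.unop)).trans
            (id₀ A.unop x))
          (fun x => id₁ A.unop x))
      map_comp := fun A B C => Biset.hom_ext
        (fun p => funext fun x => comp₀ (A := A.unop) (B := B.unop) (C := C.unop) p.1 p.2 x)
        (fun p => Biset.hom_ext
          (fun x => (congrArg (fun f => a₀ (A := A.unop) (B := C.unop) f x)
            (J.map_comp (X := C.unop) (Y := B.unop) (Z := A.unop) p.2 p.1)).trans
            (comp₀ (A := A.unop) (B := B.unop) (C := C.unop) _ _ x))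
          (fun x => comp₁ (A := A.unop) (B := B.unop) (C := C.unop) p.1 p.2 x)) }

/-- A `V`-natural transformation `F → G`: a family of morphisms `F A ⟶ G A` in `V` such that the two
composites `Cᵒᵖ(A, B) ⟶ (F A ⇒ F B) ⟶ (F A ⇒ G B)` and
`Cᵒᵖ(A, B) ⟶ (G A ⇒ G B) ⟶ (F A ⇒ G B)` in `V` agree. -/
@[ext]
structure VNatTrans (F G : CBar J) : Type u where
  app : ∀ A : (CCat J)ᵒᵖ, F.fn.obj A ⟶ G.fn.obj A
  naturality : ∀ A B : (CCat J)ᵒᵖ,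
    F.fn.map A B ≫ (ihom (F.fn.obj A)).map (app B) =
      G.fn.map A B ≫ (MonoidalClosed.pre (app A)).app (G.fn.obj B)

/-- The (underlying ordinary) presheaf category of `C`, with `V`-natural transformations as
morphisms. -/
instance : Category.{u} (CBar J) where
  Hom := VNatTrans
  id F :=
    { app := fun A => 𝟙 _
      naturality := fun A B => by simp }
  comp f g :=
    { app := fun A => f.app A ≫ g.app A
      naturality := fun A B => by
        have h := g.naturality A B
        have h' := f.naturality A B
        simp only [Functor.map_comp, MonoidalClosed.pre_map, NatTrans.comp_app]
        rw [reassoc_of% h', ← reassoc_of% h, NatTrans.naturality] }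

@[ext]
theorem hom_ext {F G : CBar J} {f g : F ⟶ G} (h : ∀ A, f.app A = g.app A) : f = g :=
  VNatTrans.ext (funext h)

@[simp] theorem id_app (F : CBar J) (A : (CCat J)ᵒᵖ) : VNatTrans.app (𝟙 F) A = 𝟙 _ := rfl

@[simp] theorem comp_app {F G H : CBar J} (f : F ⟶ G) (g : G ⟶ H) (A : (CCat J)ᵒᵖ) :
    (f ≫ g).app A = f.app A ≫ g.app A := rfl

/-- `V`-naturality is naturality in the morphisms of `Q` on level `0` and in those of `M` on
level `1`. -/
def homOfNatural {F G : CBar J} (app : ∀ A : M, F.at' A ⟶ G.at' A)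
    (h₀ : ∀ {A B : M} (f : J.obj B ⟶ J.obj A) (x : (F.at' A).obj₀),
      (app B).map₀ (F.act₀ f x) = G.act₀ f ((app A).map₀ x))
    (h₁ : ∀ {A B : M} (f : B ⟶ A) (x : (F.at' A).obj₁),
      (app B).map₁ ((F.act₁ f).map₁ x) = (G.act₁ f).map₁ ((app A).map₁ x)) : F ⟶ G where
  app := fun A => app A.unop
  naturality := fun A B => Biset.hom_ext
    (fun f => funext fun x => h₀ (A := A.unop) (B := B.unop) f x)
    (fun f => Biset.hom_ext
      (fun x => (congrArg (app B.unop).map₀ (congrFun (F.act₁_map₀ (A := A.unop) (B := B.unop) f)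
        x)).trans ((h₀ (A := A.unop) (B := B.unop) (J.map f) x).trans
          (congrFun (G.act₁_map₀ (A := A.unop) (B := B.unop) f) ((app A.unop).map₀ x)).symm))
      (fun x => h₁ (A := A.unop) (B := B.unop) f x))

/-- The ordinary presheaf `F⁰` on `Q`, `F⁰ A = (F A)₀`. -/
def zeroPart (F : CBar J) : (QOb J)ᵒᵖ ⥤ Type u where
  obj A := (F.at' A.unop).obj₀
  map {A B} f := TypeCat.ofHom (F.act₀ (A := A.unop) (B := B.unop) f.unop.hom)
  map_id A := by
    ext x
    exact F.act₀_id _ x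
  map_comp f g := by
    ext x
    exact F.act₀_comp _ _ x

/-- The pointwise coproduct `F + G`. -/
def coprod (F G : CBar J) : CBar J :=
  ofActions (fun A => ⟨(F.at' A).obj₀ ⊕ (G.at' A).obj₀, (F.at' A).obj₁ ⊕ (G.at' A).obj₁,
      Sum.map (F.at' A).str (G.at' A).str⟩)
    (fun f => Sum.map (F.act₀ f) (G.act₀ f))
    (fun f => Sum.map (F.act₁ f).map₁ (G.act₁ f).map₁)
    (by
      rintro A B f (x | x)
      · exact congrArg Sum.inl (((F.act₁ f).comm x).trans (congrFun (F.act₁_map₀ f) _))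
      · exact congrArg Sum.inr (((G.act₁ f).comm x).trans (congrFun (G.act₁_map₀ f) _)))
    (by rintro A (x | x) <;> simp [act₀_id])
    (by rintro A (x | x) <;> simp [act₁_id])
    (by rintro A B C f g (x | x) <;> simp [act₀_comp])
    (by rintro A B C f g (x | x) <;> simp [act₁_comp])

def coprodInl (F G : CBar J) : F ⟶ coprod F G :=
  homOfNatural
    (fun _ => { map₀ := Sum.inl, map₁ := Sum.inl, comm := fun _ => rfl })
    (fun _ _ => rfl) (fun _ _ => rfl)

def coprodInr (F G : CBar J) : G ⟶ coprod F G :=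
  homOfNatural
    (fun _ => { map₀ := Sum.inr, map₁ := Sum.inr, comm := fun _ => rfl })
    (fun _ _ => rfl) (fun _ _ => rfl)

/-- The `V`-enriched Yoneda embedding `y A = C(-, A)`, on objects. -/
def yonedaObj (J : M ⥤ Q) (A : M) : CBar J :=
  ofActions (fun X => EnrichedCategory.Hom (show CCat J from X) (show CCat J from A))
    (fun {X Y} (f : J.obj Y ⟶ J.obj X) (g : J.obj X ⟶ J.obj A) => f ≫ g)
    (fun {X Y} (f : Y ⟶ X) (g : X ⟶ A) => f ≫ g)
    (fun f g => J.map_comp f g)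
    (fun X (g : J.obj X ⟶ J.obj A) => Category.id_comp g)
    (fun X (g : X ⟶ A) => Category.id_comp g)
    (fun f g (h : _ ⟶ J.obj A) => Category.assoc g f h)
    (fun f g (h : _ ⟶ A) => Category.assoc g f h)

/-- The Yoneda embedding as an ordinary functor on the underlying category of `C`, which is `M`. -/
def yoneda (J : M ⥤ Q) : M ⥤ CBar J where
  obj := yonedaObj J
  map {A B} f := homOfNatural
    (fun X =>
      { map₀ := fun (g : J.obj X ⟶ J.obj A) => g ≫ J.map f
        map₁ := fun (g : X ⟶ A) => g ≫ f
        comm := fun g => J.map_comp g f })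
    (fun g (h : _ ⟶ J.obj A) => Category.assoc g h (J.map f))
    (fun g (h : _ ⟶ A) => Category.assoc g h f)
  map_id A := hom_ext fun X => Biset.hom_ext
    (fun (g : _ ⟶ J.obj A) => by
      change g ≫ J.map (𝟙 A) = g
      simp)
    (fun (g : _ ⟶ A) => Category.comp_id g)
  map_comp {A B C} f g := hom_ext fun X => Biset.hom_ext
    (fun (h : _ ⟶ J.obj A) => by
      change h ≫ J.map (f ≫ g) = (h ≫ J.map f) ≫ J.map g
      simp)
    (fun (h : _ ⟶ A) => (Category.assoc h f g).symm)

/-- The monad `T` on presheaves on objects: composition with the `V`-functor `Δ ∘ U₀`. -/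
def tObj (F : CBar J) : CBar J := ⟨(F.fn.comp Biset Biset.U₀).comp Biset Biset.Δ⟩

/-- The action of `T` on `V`-natural transformations. -/
def tMap {F G : CBar J} (f : F ⟶ G) : tObj F ⟶ tObj G where
  app A := (Biset.Δ.map _ _).map₁ ((Biset.U₀.map _ _).map₁ (f.app A))
  naturality A B := Biset.hom_ext
    (fun g => congrFun (congrArg Biset.Hom.map₀ (f.naturality A B)) g)
    (fun g => Biset.hom_ext
      (fun x => congrFun (congrArg Biset.Hom.map₀
        (congrFun (congrArg Biset.Hom.map₁ (f.naturality A B)) g)) x)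
      (fun x => congrFun (congrArg Biset.Hom.map₀
        (congrFun (congrArg Biset.Hom.map₁ (f.naturality A B)) g)) x))

/-- The unit `η : F → T F`, given by `(id, str) : F A ⟶ Δ (U₀ (F A))`. -/
def tUnit (F : CBar J) : F ⟶ tObj F :=
  homOfNatural
    (fun A => { map₀ := fun x => x, map₁ := (F.at' A).str, comm := fun _ => rfl })
    (fun _ _ => rfl) (fun f x => (F.act₁ f).comm x)

/-- The multiplication `μ : T (T F) → T F`; each component is the identity. -/
def tMul (F : CBar J) : tObj (tObj F) ⟶ tObj F :=
  homOfNatural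
    (fun _ => { map₀ := fun x => x, map₁ := fun x => x, comm := fun _ => rfl })
    (fun _ _ => rfl) (fun _ _ => rfl)

/-- The presheaf `L̃ F`, with `(L̃ F) A = ((L F⁰) A, (F A)₁, η ∘ str)`, where `L` is the left adjoint
of the inclusion of product-preserving presheaves on `Q` and `η` is the unit of this adjunction. -/
noncomputable def reflectObj (F : CBar J) : CBar J :=
  ofActions
    (fun A => ⟨((prodReflector (QOb J)).obj F.zeroPart).obj.obj (op A), (F.at' A).obj₁,
      fun x => ((prodReflectorAdj (QOb J)).unit.app F.zeroPart).app (op A) ((F.at' A).str x)⟩)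
    (fun {A B} f x => ((prodReflector (QOb J)).obj F.zeroPart).obj.map
      (Quiver.Hom.op (X := (show QOb J from B)) (Y := (show QOb J from A))
        (InducedCategory.homMk f)) x)
    (fun f => (F.act₁ f).map₁)
    (by
      intro A B f x
      have h := ConcreteCategory.congr_hom
        (((prodReflectorAdj (QOb J)).unit.app F.zeroPart).naturality
          (Quiver.Hom.op (X := (show QOb J from B)) (Y := (show QOb J from A))
            (InducedCategory.homMk (J.map f)))) ((F.at' A).str x)
      have h' : (F.at' B).str ((F.act₁ f).map₁ x) = F.act₀ (J.map f) ((F.at' A).str x) :=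
        ((F.act₁ f).comm x).trans (congrFun (F.act₁_map₀ f) _)
      exact (congrArg (fun z => ((prodReflectorAdj (QOb J)).unit.app F.zeroPart).app (op B) z)
        h').trans h)
    (by
      intro A x
      exact ConcreteCategory.congr_hom
        (((prodReflector (QOb J)).obj F.zeroPart).obj.map_id (op (show QOb J from A))) x)
    (by intro A x; rw [act₁_id]; rfl)
    (by
      intro A B C f g x
      exact ConcreteCategory.congr_hom
        (((prodReflector (QOb J)).obj F.zeroPart).obj.map_comp
          (Quiver.Hom.op (X := (show QOb J from B)) (Y := (show QOb J from A))
            (InducedCategory.homMk f))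
          (Quiver.Hom.op (X := (show QOb J from C)) (Y := (show QOb J from B))
            (InducedCategory.homMk g))) x)
    (by intro A B C f g x; rw [act₁_comp]; rfl)

/-- The unit `F → L̃ F` of the reflection. -/
noncomputable def reflectUnit (F : CBar J) : F ⟶ reflectObj F :=
  homOfNatural
    (fun A =>
      { map₀ := fun x => ((prodReflectorAdj (QOb J)).unit.app F.zeroPart).app (op A) x
        map₁ := fun x => x
        comm := fun _ => rfl })
    (by
      intro A B f x
      exact ConcreteCategory.congr_hom
        (((prodReflectorAdj (QOb J)).unit.app F.zeroPart).naturality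
          (Quiver.Hom.op (X := (show QOb J from B)) (Y := (show QOb J from A))
            (InducedCategory.homMk f))) x)
    (fun _ _ => rfl)

end CBar

/-! ### The reflective subcategory of smooth functors -/

/-- A `V`-functor `F : Cᵒᵖ → V` is smooth if `F⁰ : Qᵒᵖ → Set` preserves binary products. -/
def smooth (J : M ⥤ Q) : ObjectProperty (CBar J) := fun F => prodPreserving (QOb J) F.zeroPart

/-- The category `C̃` of smooth functors. -/
abbrev CTilde (J : M ⥤ Q) : Type (u + 1) := (smooth J).FullSubcategory

theorem smooth_yoneda (J : M ⥤ Q) (A : M) : smooth J ((CBar.yoneda J).obj A) := by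
  have e : CategoryTheory.yoneda.obj (show QOb J from A) ≅ ((CBar.yoneda J).obj A).zeroPart :=
    NatIso.ofComponents
      (fun X => (InducedCategory.homEquiv (X := X.unop) (Y := (show QOb J from A))).toIso)
      (fun f => rfl)
  exact preservesLimitsOfShape_of_natIso e

theorem smooth_tObj {J : M ⥤ Q} {F : CBar J} (h : smooth J F) : smooth J F.tObj := h

theorem smooth_reflectObj {J : M ⥤ Q} (F : CBar J) : smooth J F.reflectObj :=
  ((prodReflector (QOb J)).obj F.zeroPart).property

namespace CTilde

/-- The Lambek embedding `ȳ`, on the underlying category `M` of `C`. -/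
def lambek (J : M ⥤ Q) : M ⥤ CTilde J :=
  (smooth J).lift (CBar.yoneda J) (smooth_yoneda J)

/-- The monad `T̃` on `C̃`, the restriction of `T` to smooth functors. -/
def T (J : M ⥤ Q) : Monad (CTilde J) where
  obj F := ⟨F.obj.tObj, smooth_tObj F.property⟩
  map f := ObjectProperty.homMk (CBar.tMap f.hom)
  map_id _ := rfl
  map_comp _ _ := rfl
  η := { app := fun F => ObjectProperty.homMk F.obj.tUnit
         naturality := fun _ _ f => ObjectProperty.hom_ext _ (CBar.hom_ext fun A =>
           Biset.hom_ext (fun _ => rfl) (fun x => (f.hom.app A).comm x)) }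
  μ := { app := fun F => ObjectProperty.homMk F.obj.tMul
         naturality := fun _ _ _ => rfl }
  assoc _ := rfl
  left_unit _ := rfl
  right_unit _ := rfl

/-- The coproduct `F +' G = L̃ (F + G)` in `C̃`. -/
noncomputable def coprod {J : M ⥤ Q} (F G : CTilde J) : CTilde J :=
  ⟨(F.obj.coprod G.obj).reflectObj, smooth_reflectObj _⟩

/-- The left injection into the coproduct. -/
noncomputable def inl {J : M ⥤ Q} (F G : CTilde J) : F ⟶ coprod F G :=
  ObjectProperty.homMk (CBar.coprodInl F.obj G.obj ≫ CBar.reflectUnit _)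

/-- The right injection into the coproduct. -/
noncomputable def inr {J : M ⥤ Q} (F G : CTilde J) : G ⟶ coprod F G :=
  ObjectProperty.homMk (CBar.coprodInr F.obj G.obj ≫ CBar.reflectUnit _)

/-- `Bool = ȳI +' ȳI`. -/
noncomputable def bool (J : M ⥤ Q) [MonoidalCategory M] : CTilde J :=
  coprod ((lambek J).obj (𝟙_ M)) ((lambek J).obj (𝟙_ M))

end CTilde

end Model

/-! The functor `F ↦ F⁰` from smooth functors to product-preserving presheaves on `Q` has the right
adjoint `Δ`, so it carries the coproduct `Bool = ȳI +' ȳI` to a coproduct. It also carries `ȳ` to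
`κ J`, and `κ` preserves coproducts: for a product-preserving presheaf `G`, the Yoneda lemma
identifies `Hom(κ(-), G)` with `G`, which turns coproducts into products. Hence `init⁰` is the
comparison of two coproducts `κI + κI`, thus invertible. The monad `T̃` is `Δ (-)⁰`, so `T̃ init` is
invertible too, and `Dyn` can only be `η ≫ (T̃ init)⁻¹`. -/

theorem isIso_map_of_isColimit_mapCocone {C D S : Type*} [Category* C] [Category* D] [Category* S]
    (G : C ⥤ D) {K : S ⥤ C} [PreservesColimit K G] {s t : Cocone K} (hs : IsColimit s)
    (ht : IsColimit (G.mapCocone t)) (f : s ⟶ t) : IsIso (G.map f.hom) :=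
  have := (isColimitOfPreserves G hs).hom_isIso ht ((Cocone.functoriality K G).map f)
  inferInstanceAs (IsIso ((Cocone.forget (K ⋙ G)).map ((Cocone.functoriality K G).map f)))

section Presheaf

variable {D : Type u} [SmallCategory D]

/-- The Yoneda lemma for product-preserving presheaves: `Hom(κ(-), G) ≅ G`. -/
def lambekQOpCompYonedaObjIso (G : (prodPreserving D).FullSubcategory) :
    (lambekQ D).op ⋙ yoneda.obj G ≅ G.obj :=
  NatIso.ofComponents
    (fun _ => ((prodPreserving D).fullyFaithfulι.homEquiv.trans yonedaEquiv).toIso)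
    (fun f => by
      ext φ
      exact (yonedaEquiv_naturality φ.hom f.unop).symm)

instance preservesColimitsOfShape_lambekQ :
    PreservesColimitsOfShape (Discrete WalkingPair) (lambekQ D) where
  preservesColimit :=
    { preserves := fun {c} hc => by
        refine ⟨(Cocone.isColimitYonedaEquiv _).symm fun G => ?_⟩
        have : PreservesLimitsOfShape (Discrete WalkingPair) G.obj := G.property
        have : PreservesLimitsOfShape (Discrete WalkingPair)ᵒᵖ G.obj :=
          preservesLimitsOfShape_of_equiv (Discrete.opposite WalkingPair).symm G.obj
        have : PreservesLimitsOfShape (Discrete WalkingPair)ᵒᵖ ((lambekQ D).op ⋙ yoneda.obj G) :=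
          preservesLimitsOfShape_of_natIso (lambekQOpCompYonedaObjIso G).symm
        exact isLimitOfPreserves ((lambekQ D).op ⋙ yoneda.obj G) hc.op }

end Presheaf

section Model

variable {M Q : Type u} [SmallCategory M] [SmallCategory Q]

/-- The functor `J`, corestricted to the copy `QOb J` of `Q` with the objects of `M`. -/
def toQOb (J : M ⥤ Q) : M ⥤ QOb J where
  obj A := A
  map f := InducedCategory.homMk (J.map f)

namespace CBar

variable {J : M ⥤ Q} {F G H : CBar J}

section Components

variable {A B : M}

theorem str_act₁ (F : CBar J) (f : B ⟶ A) (x : (F.at' A).obj₁) :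
    (F.at' B).str ((F.act₁ f).map₁ x) = F.act₀ (J.map f) ((F.at' A).str x) :=
  ((F.act₁ f).comm x).trans (congrFun (F.act₁_map₀ f) _)

theorem app_act₀ (φ : F ⟶ G) (f : J.obj B ⟶ J.obj A) (x : (F.at' A).obj₀) :
    (φ.app (op B)).map₀ (F.act₀ f x) = G.act₀ f ((φ.app (op A)).map₀ x) :=
  congrFun (congrFun (congrArg Biset.Hom.map₀ (φ.naturality (op A) (op B))) f) x

theorem app_act₁ (φ : F ⟶ G) (f : B ⟶ A) (x : (F.at' A).obj₁) :
    (φ.app (op B)).map₁ ((F.act₁ f).map₁ x) = (G.act₁ f).map₁ ((φ.app (op A)).map₁ x) :=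
  congrFun (congrArg Biset.Hom.map₁
    (congrFun (congrArg Biset.Hom.map₁ (φ.naturality (op A) (op B))) f)) x

theorem zeroPart_app_act₀ (φ : F.zeroPart ⟶ G.zeroPart) (f : J.obj B ⟶ J.obj A)
    (x : (F.at' A).obj₀) : φ.app (op B) (F.act₀ f x) = G.act₀ f (φ.app (op A) x) :=
  ConcreteCategory.congr_hom
    (φ.naturality (Quiver.Hom.op (X := (show QOb J from B)) (Y := (show QOb J from A))
      (InducedCategory.homMk f))) x

end Components

/-- The functor `F ↦ F⁰` from `V`-functors `Cᵒᵖ → V` to presheaves on `Q`. -/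
def zeroFunctor (J : M ⥤ Q) : CBar J ⥤ (QOb J)ᵒᵖ ⥤ Type u where
  obj := zeroPart
  map φ :=
    { app := fun A => TypeCat.ofHom (φ.app (op A.unop)).map₀
      naturality := fun A B f => by
        ext x
        exact app_act₀ (J := J) φ (A := A.unop) (B := B.unop) f.unop.hom x }

theorem hom_ext_of_zeroFunctor {φ ψ : F ⟶ G}
    (h₀ : (zeroFunctor J).map φ = (zeroFunctor J).map ψ)
    (h₁ : ∀ (A : M) (x : (F.at' A).obj₁), (φ.app (op A)).map₁ x = (ψ.app (op A)).map₁ x) :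
    φ = ψ :=
  hom_ext fun A => Biset.hom_ext (ConcreteCategory.congr_hom (NatTrans.congr_app h₀ (op A.unop)))
    (h₁ A.unop)

/-- A `V`-natural transformation given by a natural transformation on level `0` and a compatible
family of functions on level `1`. -/
def homOfZeroPart (φ : F.zeroPart ⟶ G.zeroPart)
    (map₁ : ∀ A : M, (F.at' A).obj₁ → (G.at' A).obj₁)
    (comm : ∀ (A : M) (x : (F.at' A).obj₁),
      (G.at' A).str (map₁ A x) = φ.app (op A) ((F.at' A).str x))
    (natural : ∀ {A B : M} (f : B ⟶ A) (x : (F.at' A).obj₁),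
      map₁ B ((F.act₁ f).map₁ x) = (G.act₁ f).map₁ (map₁ A x)) : F ⟶ G :=
  homOfNatural (fun A => { map₀ := fun x => φ.app (op A) x, map₁ := map₁ A, comm := comm A })
    (zeroPart_app_act₀ φ) natural

/-- The copairing `F + G ⟶ H`. -/
def coprodDesc (φ : F ⟶ H) (ψ : G ⟶ H) : coprod F G ⟶ H :=
  homOfNatural
    (fun A =>
      { map₀ := Sum.elim (φ.app (op A)).map₀ (ψ.app (op A)).map₀
        map₁ := Sum.elim (φ.app (op A)).map₁ (ψ.app (op A)).map₁
        comm := Sum.rec (φ.app (op A)).comm (ψ.app (op A)).comm })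
    (fun f => Sum.rec (app_act₀ φ f) (app_act₀ ψ f))
    (fun f => Sum.rec (app_act₁ φ f) (app_act₁ ψ f))

theorem coprod_hom_ext {φ ψ : coprod F G ⟶ H}
    (hl : coprodInl F G ≫ φ = coprodInl F G ≫ ψ) (hr : coprodInr F G ≫ φ = coprodInr F G ≫ ψ) :
    φ = ψ := by
  refine hom_ext fun A => Biset.hom_ext (Sum.rec ?_ ?_) (Sum.rec ?_ ?_)
  · exact congrFun (congrArg (fun χ => (VNatTrans.app χ A).map₀) hl)
  · exact congrFun (congrArg (fun χ => (VNatTrans.app χ A).map₀) hr)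
  · exact congrFun (congrArg (fun χ => (VNatTrans.app χ A).map₁) hl)
  · exact congrFun (congrArg (fun χ => (VNatTrans.app χ A).map₁) hr)

/-- The universal property of `L F⁰` with respect to the level `0` of a smooth functor. -/
noncomputable abbrev zeroPartReflectHomEquiv (F : CBar J) (hG : smooth J G) :
    ((prodReflector (QOb J)).obj F.zeroPart ⟶ ⟨G.zeroPart, hG⟩) ≃ (F.zeroPart ⟶ G.zeroPart) :=
  (prodReflectorAdj (QOb J)).homEquiv F.zeroPart ⟨G.zeroPart, hG⟩

/-- The universal property of the reflection `L̃ F`: it is that of `L F⁰` on level `0`, while level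
`1` is left unchanged. -/
noncomputable def reflectHomEquiv (hG : smooth J G) : (reflectObj F ⟶ G) ≃ (F ⟶ G) where
  toFun ψ := reflectUnit F ≫ ψ
  invFun φ :=
    homOfZeroPart ((zeroPartReflectHomEquiv F hG).symm ((zeroFunctor J).map φ)).hom
      (fun A => (φ.app (op A)).map₁)
      (fun A x => ((φ.app (op A)).comm x).trans (ConcreteCategory.congr_hom (NatTrans.congr_app
        ((zeroPartReflectHomEquiv F hG).apply_symm_apply ((zeroFunctor J).map φ)) (op A)) _).symm)
      (app_act₁ φ)
  left_inv ψ := hom_ext_of_zeroFunctor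
    (congrArg (·.hom) ((zeroPartReflectHomEquiv F hG).symm_apply_apply
      (ObjectProperty.homMk ((zeroFunctor J).map ψ))))
    (fun _ _ => rfl)
  right_inv _ := hom_ext_of_zeroFunctor
    ((zeroPartReflectHomEquiv F hG).apply_symm_apply _) (fun _ _ => rfl)

/-- The `V`-functor `Δ P` with `(Δ P) A = (P A, P A, id)`. -/
def diag (P : (QOb J)ᵒᵖ ⥤ Type u) : CBar J :=
  ofActions (fun A => ⟨P.obj (op A), P.obj (op A), fun x => x⟩)
    (fun {A B} f x => P.map (Quiver.Hom.op (X := (show QOb J from B)) (Y := (show QOb J from A))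
      (InducedCategory.homMk f)) x)
    (fun f x => P.map ((toQOb J).map f).op x)
    (fun _ _ => rfl)
    (fun A => ConcreteCategory.congr_hom (P.map_id (op (show QOb J from A))))
    (fun A => ConcreteCategory.congr_hom (((toQOb J).op ⋙ P).map_id (op A)))
    (fun {A B C} f g => ConcreteCategory.congr_hom (P.map_comp
      (Quiver.Hom.op (X := (show QOb J from B)) (Y := (show QOb J from A))
        (InducedCategory.homMk f))
      (Quiver.Hom.op (X := (show QOb J from C)) (Y := (show QOb J from B))
        (InducedCategory.homMk g))))
    (fun f g => ConcreteCategory.congr_hom (((toQOb J).op ⋙ P).map_comp f.op g.op))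

/-- The functor `Δ` from presheaves on `Q` to `V`-functors `Cᵒᵖ → V`. -/
def diagFunctor (J : M ⥤ Q) : ((QOb J)ᵒᵖ ⥤ Type u) ⥤ CBar J where
  obj := diag
  map {P R} φ := homOfZeroPart (F := diag P) (G := diag R) φ (fun A x => φ.app (op A) x)
    (fun _ _ => rfl)
    (fun f => ConcreteCategory.congr_hom (φ.naturality ((toQOb J).map f).op))

/-- The functor `F ↦ F⁰` is left adjoint to `Δ`. -/
def zeroDiagAdj (J : M ⥤ Q) : zeroFunctor J ⊣ diagFunctor J :=
  .mkOfUnitCounit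
    { unit :=
        { app := fun F => homOfZeroPart (G := diag F.zeroPart) (𝟙 F.zeroPart)
            (fun A => (F.at' A).str) (fun _ _ => rfl) F.str_act₁
          naturality := fun _ _ φ =>
            hom_ext_of_zeroFunctor rfl (fun A => (φ.app (op A)).comm) }
      counit := { app := fun P => 𝟙 P } }

/-- The identification `Δ F⁰ ≅ T F`, given by identities. The two `V`-functors are not
definitionally equal: on level `1`, a morphism `f` of `M` acts by `act₀ (J.map f)` on the left, and
by `(act₁ f).map₀` on the right. -/
def diagZeroPartIso (F : CBar J) : diag F.zeroPart ≅ tObj F where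
  hom := homOfZeroPart (G := tObj F) (𝟙 F.zeroPart) (fun _ x => x) (fun _ _ => rfl)
    (fun f => congrFun (F.act₁_map₀ f).symm)
  inv := homOfZeroPart (F := tObj F) (G := diag F.zeroPart) (𝟙 F.zeroPart) (fun _ x => x)
    (fun _ _ => rfl) (fun f => congrFun (F.act₁_map₀ f))

end CBar

namespace CTilde

/-- The functor `F ↦ F⁰` from smooth functors to product-preserving presheaves on `Q`. -/
def zeroFunctor (J : M ⥤ Q) : CTilde J ⥤ (prodPreserving (QOb J)).FullSubcategory :=
  (prodPreserving (QOb J)).lift ((smooth J).ι ⋙ CBar.zeroFunctor J) (fun F => F.property)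

/-- The functor `Δ` from product-preserving presheaves on `Q` to smooth functors. -/
def diagFunctor (J : M ⥤ Q) : (prodPreserving (QOb J)).FullSubcategory ⥤ CTilde J :=
  (smooth J).lift ((prodPreserving (QOb J)).ι ⋙ CBar.diagFunctor J) (fun P => P.property)

/-- The adjunction `CBar.zeroDiagAdj`, restricted to smooth functors. -/
noncomputable def zeroDiagAdj (J : M ⥤ Q) : zeroFunctor J ⊣ diagFunctor J :=
  (CBar.zeroDiagAdj J).restrictFullyFaithful (smooth J).fullyFaithfulι
    (prodPreserving (QOb J)).fullyFaithfulι (Iso.refl _) (Iso.refl _)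

instance isLeftAdjoint_zeroFunctor (J : M ⥤ Q) : (zeroFunctor J).IsLeftAdjoint :=
  (zeroDiagAdj J).isLeftAdjoint

/-- The decomposition `T̃ ≅ Δ (-)⁰`. -/
def zeroFunctorCompDiagFunctorIso (J : M ⥤ Q) : zeroFunctor J ⋙ diagFunctor J ≅ (T J).toFunctor :=
  NatIso.ofComponents (fun F => (smooth J).isoMk (CBar.diagZeroPartIso F.obj)) (fun _ => rfl)

/-- The isomorphism `(ȳ A)⁰ ≅ κ (J A)`, natural in `A`. -/
def lambekCompZeroFunctorIso (J : M ⥤ Q) :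
    lambek J ⋙ zeroFunctor J ≅ toQOb J ⋙ lambekQ (QOb J) :=
  NatIso.ofComponents
    (fun A => (prodPreserving (QOb J)).isoMk (NatIso.ofComponents
      (fun X => (InducedCategory.homEquiv (X := X.unop) (Y := (show QOb J from A))).symm.toIso)
      (fun _ => rfl)))
    (fun _ => rfl)

variable {J : M ⥤ Q}

theorem isIso_T_map {F G : CTilde J} (f : F ⟶ G) [IsIso ((zeroFunctor J).map f)] :
    IsIso ((T J).map f) :=
  (NatIso.isIso_map_iff (zeroFunctorCompDiagFunctorIso J) f).1
    (inferInstanceAs (IsIso ((diagFunctor J).map ((zeroFunctor J).map f))))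

/-- The copairing `F +' G ⟶ H`. -/
noncomputable def coprodDesc {F G H : CTilde J} (f : F ⟶ H) (g : G ⟶ H) : coprod F G ⟶ H :=
  ObjectProperty.homMk ((CBar.reflectHomEquiv H.property).symm (CBar.coprodDesc f.hom g.hom))

theorem inl_coprodDesc {F G H : CTilde J} (f : F ⟶ H) (g : G ⟶ H) :
    inl F G ≫ coprodDesc f g = f :=
  ObjectProperty.hom_ext _ (congrArg (CBar.coprodInl F.obj G.obj ≫ ·)
    ((CBar.reflectHomEquiv H.property).apply_symm_apply (CBar.coprodDesc f.hom g.hom)))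

theorem inr_coprodDesc {F G H : CTilde J} (f : F ⟶ H) (g : G ⟶ H) :
    inr F G ≫ coprodDesc f g = g :=
  ObjectProperty.hom_ext _ (congrArg (CBar.coprodInr F.obj G.obj ≫ ·)
    ((CBar.reflectHomEquiv H.property).apply_symm_apply (CBar.coprodDesc f.hom g.hom)))

theorem coprod_hom_ext {F G H : CTilde J} {φ ψ : coprod F G ⟶ H}
    (hl : inl F G ≫ φ = inl F G ≫ ψ) (hr : inr F G ≫ φ = inr F G ≫ ψ) : φ = ψ :=
  ObjectProperty.hom_ext _ ((CBar.reflectHomEquiv H.property).injective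
    (CBar.coprod_hom_ext (congrArg (·.hom) hl) (congrArg (·.hom) hr)))

noncomputable def coprodIsColimit (F G : CTilde J) :
    IsColimit (BinaryCofan.mk (inl F G) (inr F G)) :=
  BinaryCofan.IsColimit.mk _ coprodDesc inl_coprodDesc inr_coprodDesc fun f g _ hl hr =>
    coprod_hom_ext (hl.trans (inl_coprodDesc f g).symm) (hr.trans (inr_coprodDesc f g).symm)

section Bit

variable {A B S : M} {a : A ⟶ S} {b : B ⟶ S}

noncomputable def isColimitZeroFunctorMapLambekMap
    (h : IsColimit (BinaryCofan.mk (J.map a) (J.map b))) :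
    IsColimit (BinaryCofan.mk ((zeroFunctor J).map ((lambek J).map a))
      ((zeroFunctor J).map ((lambek J).map b))) :=
  have hQ : IsColimit (BinaryCofan.mk ((toQOb J).map a) ((toQOb J).map b)) :=
    isColimitOfReflectsOfMapIsColimit (inducedFunctor J.obj) _ _ h
  have hκ : IsColimit ((toQOb J ⋙ lambekQ (QOb J)).mapCocone (BinaryCofan.mk a b)) :=
    (isColimitMapCoconeBinaryCofanEquiv (toQOb J ⋙ lambekQ (QOb J)) a b).symm
      (mapIsColimitOfPreservesOfIsColimit (lambekQ (QOb J)) _ _ hQ)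
  isColimitMapCoconeBinaryCofanEquiv (lambek J ⋙ zeroFunctor J) a b
    (IsColimit.mapCoconeEquiv (lambekCompZeroFunctorIso J).symm hκ)

theorem isIso_T_map_coprodDesc_lambek_map (h : IsColimit (BinaryCofan.mk (J.map a) (J.map b))) :
    IsIso ((T J).map (coprodDesc ((lambek J).map a) ((lambek J).map b))) := by
  let copairing : BinaryCofan.mk (inl _ _) (inr _ _) ⟶
      BinaryCofan.mk ((lambek J).map a) ((lambek J).map b) :=
    { hom := coprodDesc ((lambek J).map a) ((lambek J).map b)
      w := by
        rintro ⟨⟨⟩⟩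
        · exact inl_coprodDesc _ _
        · exact inr_coprodDesc _ _ }
  have : IsIso ((zeroFunctor J).map (coprodDesc ((lambek J).map a) ((lambek J).map b))) :=
    isIso_map_of_isColimit_mapCocone (zeroFunctor J) (coprodIsColimit _ _)
      ((isColimitMapCoconeBinaryCofanEquiv (zeroFunctor J) _ _).symm
        (isColimitZeroFunctorMapLambekMap h)) copairing
  exact isIso_T_map _

end Bit

end CTilde

end Model

theorem mainTheorem2_general {M Q : Type u} [SmallCategory M] [SmallCategory Q] (J : M ⥤ Q)
    {A B Bit : M} (zero : A ⟶ Bit) (one : B ⟶ Bit)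
    {X Y : Q} {inj₁ : X ⟶ J.obj Bit} {inj₂ : Y ⟶ J.obj Bit}
    (hcoprod : Nonempty (IsColimit (BinaryCofan.mk inj₁ inj₂)))
    (e₁ : X ≅ J.obj A) (e₂ : Y ≅ J.obj B)
    (hzero : e₁.hom ≫ J.map zero = inj₁) (hone : e₂.hom ≫ J.map one = inj₂) :
    Nonempty (IsColimit (BinaryCofan.mk ((lambekQ Q).map inj₁) ((lambekQ Q).map inj₂))) ∧
    ∃ (init : CTilde.coprod ((CTilde.lambek J).obj A) ((CTilde.lambek J).obj B) ⟶
        (CTilde.lambek J).obj Bit)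
      (Dyn : (CTilde.lambek J).obj Bit ⟶ (CTilde.T J).obj (CTilde.coprod _ _)),
      CTilde.inl _ _ ≫ init = (CTilde.lambek J).map zero ∧
      CTilde.inr _ _ ≫ init = (CTilde.lambek J).map one ∧
      IsIso ((CTilde.T J).map init) ∧
      Dyn ≫ (CTilde.T J).map init = (CTilde.T J).η.app ((CTilde.lambek J).obj Bit) ∧
      init ≫ Dyn = (CTilde.T J).η.app (CTilde.coprod _ _) := by
  obtain ⟨hc⟩ := hcoprod
  have hmap : IsColimit (BinaryCofan.mk (J.map zero) (J.map one)) := by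
    rw [(Iso.eq_inv_comp e₁).2 hzero, (Iso.eq_inv_comp e₂).2 hone]
    exact BinaryCofan.isColimitCompRightIso _ e₂.inv
      (BinaryCofan.isColimitCompLeftIso _ e₁.inv hc)
  let init := CTilde.coprodDesc ((CTilde.lambek J).map zero) ((CTilde.lambek J).map one)
  have : IsIso ((CTilde.T J).map init) := CTilde.isIso_T_map_coprodDesc_lambek_map hmap
  let Dyn := (CTilde.T J).η.app ((CTilde.lambek J).obj Bit) ≫ inv ((CTilde.T J).map init)
  refine ⟨⟨mapIsColimitOfPreservesOfIsColimit (lambekQ Q) _ _ hc⟩, init, Dyn,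
    CTilde.inl_coprodDesc _ _, CTilde.inr_coprodDesc _ _, this, ?_, ?_⟩
  · rw [Category.assoc, IsIso.inv_hom_id, Category.comp_id]
  · rw [Monad.unit_naturality_assoc, IsIso.hom_inv_id, Category.comp_id]

theorem mainTheorem2 {M Q : Type u} [SmallCategory M] [MonoidalCategory M] [SymmetricCategory M]
    [SmallCategory Q] [MonoidalCategory Q] [SymmetricCategory Q]
    (J : M ⥤ Q) [J.Monoidal] (hJ : IsStrictMonoidal J) (hobj : Function.Bijective J.obj)
    (Bit : M) (zero one : 𝟙_ M ⟶ Bit)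
    (inj₁ inj₂ : 𝟙_ Q ⟶ J.obj Bit)
    (hcoprod : Nonempty (IsColimit (BinaryCofan.mk inj₁ inj₂)))
    (hdistrib : ∀ A : Q, Nonempty (IsColimit (BinaryCofan.mk (A ◁ inj₁) (A ◁ inj₂))))
    (hzero : Functor.LaxMonoidal.ε J ≫ J.map zero = inj₁)
    (hone : Functor.LaxMonoidal.ε J ≫ J.map one = inj₂) :
    Nonempty (IsColimit (BinaryCofan.mk ((lambekQ Q).map inj₁) ((lambekQ Q).map inj₂))) ∧
    ∃ (init : CTilde.bool J ⟶ (CTilde.lambek J).obj Bit)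
      (Dyn : (CTilde.lambek J).obj Bit ⟶ (CTilde.T J).obj (CTilde.bool J)),
      CTilde.inl _ _ ≫ init = (CTilde.lambek J).map zero ∧
      CTilde.inr _ _ ≫ init = (CTilde.lambek J).map one ∧
      IsIso ((CTilde.T J).map init) ∧
      Dyn ≫ (CTilde.T J).map init = (CTilde.T J).η.app ((CTilde.lambek J).obj Bit) ∧
      init ≫ Dyn = (CTilde.T J).η.app (CTilde.bool J) :=
  mainTheorem2_general J zero one hcoprod (Functor.Monoidal.εIso J) (Functor.Monoidal.εIso J)
    hzero hone
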